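/- Let $V$ be a set of variables and $Pred$ a set of predicate symbols, each $P\in Pred$ with an arity $ar(P)\in\mathbb N$. The formulas of LFD (the logic of functional dependence) are $$\varphi ::= \bot \mid P x_1\ldots x_n \mid \neg\varphi \mid \varphi\wedge\varphi \mid \mathbb D_X\varphi \mid D_X y ,$$ where $x_1,\dots,x_n,y\in V$, $n=ar(P)$, and $X\subseteq V$ is finite. A dependence model consists of a domain $O$, an interpretation $I(P)\subseteq O^{ar(P)}$ of each predicate symbol $P$, and a set $A\subseteq O^V$ of admissible assignments. For $s,t\in O^V$ and $X\subseteq V$ write $s=_X t$ if $s(x)=t(x)$ for all $x\in X$. Truth at $s\in A$ is defined by: $s\not\models\bot$; $s\models Px_1\ldots x_n$ iff $(s(x_1),\dots,s(x_n))\in I(P)$; $\neg$ and $\wedge$ are Boolean; $s\models\mathbb D_X\varphi$ iff $t\models\varphi$ for all $t\in A$ with $s=_X t$; $s\models D_X y$ iff $s(y)=t(y)$ for all $t\in A$ with $s=_X t$. For sets $\Gamma,\Delta$ of formulas, the sequent $\Gamma\vdash\Delta$ is valid if in every dependence model, every admissible assignment that satisfies all formulas of $\Gamma$ satisfies at least one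 formula of $\Delta$. $Var(\Gamma)$ is the set of all variables that occur (freely or not) in formulas of $\Gamma$, where the variables occurring in $\mathbb D_X\varphi$ are those in $X$ and those in $\varphi$, and the variables occurring in $D_X y$ are those in $X\cup\{y\}$. **Theorem (Strong Interpolation).** If $\Gamma\vdash\Delta$ is valid, then there is a formula $\theta$ such that 1. $\Gamma\vdash\{\theta\}$ and $\{\theta\}\vdash\Delta$ are valid; 2. every predicate symbol that occurs in $\theta$ occurs both in $\Gamma$ and in $\Delta$; 3. every variable that occurs in $\theta$ occurs both in $\Gamma$ and in $\Delta$, i.e. $Var(\theta)\subseteq Var(\Gamma)\cap Var(\Delta)$. -/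

import Mathlib

universe u v w

namespace LFD

/-- Formulas of LFD over a set `V` of variables and a set `Pred` of predicate symbols with arities
`ar`: `P x₁ … xₙ`, `¬ φ`, `φ ∧ ψ`, the dependence modality `𝔻_X φ` (`box X φ`) and the dependence
atom `D_X y` (`dep X y`), where `X` is a finite set of variables. The Boolean constant `⊥` is
a formula in which no variable and no predicate symbol occurs. -/
inductive Formula (V : Type u) {Pred : Type v} (ar : Pred → ℕ) : Type (max u v)
  | bot : Formula V ar
  | atom (P : Pred) (x : Fin (ar P) → V) : Formula V ar
  | neg (φ : Formula V ar) : Formula V ar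
  | and (φ ψ : Formula V ar) : Formula V ar
  | box (X : Finset V) (φ : Formula V ar) : Formula V ar
  | dep (X : Finset V) (y : V) : Formula V ar

/-- A dependence model: a relational structure `(O, I)` with a set `A` of admissible assignments
of objects to variables. -/
structure DepModel (V : Type u) {Pred : Type v} (ar : Pred → ℕ) where
  /-- the domain of objects -/
  O : Type w
  /-- the interpretation of the predicate symbols -/
  I : (P : Pred) → Set (Fin (ar P) → O)
  /-- the admissible assignments -/
  A : Set (V → O)

variable {V : Type u} {Pred : Type v} {ar : Pred → ℕ}

/-- Agreement `s =_X t`. -/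
def Agree {O : Type w} (X : Set V) (s t : V → O) : Prop := ∀ x ∈ X, s x = t x

/-- Local dependence `D^s_X y` in a model `M`. -/
def DepModel.LocDep (M : DepModel.{u, v, w} V ar) (s : V → M.O) (X : Set V) (y : V) : Prop :=
  ∀ t ∈ M.A, Agree X s t → s y = t y

/-- Truth `M, s ⊨ φ`; it is used only at admissible assignments `s`. -/
def DepModel.Sat (M : DepModel.{u, v, w} V ar) : (V → M.O) → Formula V ar → Prop
  | _, .bot => False
  | s, .atom P x => (fun i => s (x i)) ∈ M.I P
  | s, .neg φ => ¬ M.Sat s φ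
  | s, .and φ ψ => M.Sat s φ ∧ M.Sat s ψ
  | s, .box X φ => ∀ t ∈ M.A, Agree (X : Set V) s t → M.Sat t φ
  | s, .dep X y => M.LocDep s (X : Set V) y

/-- The variables occurring (free or not) in a formula. -/
def Formula.vars : Formula V ar → Set V
  | .bot => ∅
  | .atom _ x => Set.range x
  | .neg φ => φ.vars
  | .and φ ψ => φ.vars ∪ ψ.vars
  | .box X φ => (X : Set V) ∪ φ.vars
  | .dep X y => (X : Set V) ∪ {y}

/-- The predicate symbols occurring in a formula. -/
def Formula.preds : Formula V ar → Set Pred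
  | .bot => ∅
  | .atom P _ => {P}
  | .neg φ => φ.preds
  | .and φ ψ => φ.preds ∪ ψ.preds
  | .box _ φ => φ.preds
  | .dep _ _ => ∅

/-- `Var(Γ)`: the variables occurring in some formula of `Γ`. -/
def Var (Γ : Set (Formula V ar)) : Set V := ⋃ φ ∈ Γ, φ.vars

/-- The predicate symbols occurring in some formula of `Γ`. -/
def PredSym (Γ : Set (Formula V ar)) : Set Pred := ⋃ φ ∈ Γ, φ.preds

/-- The sequent `Γ ⊢ Δ` is valid: in every dependence model, each admissible assignment that
satisfies all formulas of `Γ` satisfies some formula of `Δ`. Domains range over the universe of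
the formulas; by the downward Löwenheim–Skolem argument, larger domains give the same notion. -/
def ValidSeq (Γ Δ : Set (Formula V ar)) : Prop :=
  ∀ M : DepModel.{u, v, max u v} V ar, ∀ s ∈ M.A, (∀ φ ∈ Γ, M.Sat s φ) → ∃ ψ ∈ Δ, M.Sat s ψ

/-- `θ` is a strong interpolant for the sequent `Γ ⊢ Δ`. -/
structure StrongInterpolant (Γ Δ : Set (Formula V ar)) (θ : Formula V ar) : Prop where
  valid_left : ValidSeq Γ {θ}
  valid_right : ValidSeq {θ} Δ
  preds_subset : θ.preds ⊆ PredSym Γ ∩ PredSym Δ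
  vars_subset : θ.vars ⊆ Var Γ ∩ Var Δ

end LFD

namespace LFD

open Filter

variable {V : Type u} {Pred : Type v} {ar : Pred → ℕ}

/-! A failure of interpolation yields a countermodel. By compactness `Γ` may be taken finite, so
that there are finitely many common variables. If no formula of the common language separates `Γ`
from `Δ`, compactness also gives complete theories, one containing `Γ` and one containing the
negations of `Δ`, that agree on the common language (`exists_types_of_no_separation`).
`amalgamation` realizes both at one admissible assignment, each for its own language, which refutes
the sequent.

The joint model is an unravelling. Its worlds are pairs of theories that agree on the common
language. A step keeps the values of a set `Y` of variables and renews all others; a history assigns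
to each variable the point at which it was last renewed. A demand raised by one theory must be met
by a step that both theories allow (`zig_box`, `zig_dep`), so `Y` has to be closed under the
dependences of both; this is possible because dependence atoms over common variables are shared
(`exists_closure`). Truth in the model is computed in `sat_historyModel_iff`, which rests on
`eq_of_value_eq`. -/

/-! ### Compactness -/

/-- `T` holds at some admissible assignment of some dependence model. -/
def Satisfiable (T : Set (Formula V ar)) : Prop :=
  ∃ M : DepModel.{u, v, max u v} V ar, ∃ s ∈ M.A, ∀ φ ∈ T, M.Sat s φ

section Ultraproduct

variable {ι : Type w} (U : Ultrafilter ι) (M : ι → DepModel.{u, v, w} V ar)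

/-- The assignment into the ultraproduct induced by a family of assignments. -/
def ultraAssign (s : (i : ι) → V → (M i).O) : V → (U : Filter ι).Product (fun i => (M i).O) :=
  fun x => Quotient.mk (productSetoid (U : Filter ι) (fun i => (M i).O)) (fun i => s i x)

/-- The ultraproduct of a family of dependence models. -/
def ultraproduct : DepModel.{u, v, w} V ar where
  O := (U : Filter ι).Product (fun i => (M i).O)
  I P := {o | ∃ f : Fin (ar P) → (i : ι) → (M i).O,
    (∀ j, o j = Quotient.mk (productSetoid (U : Filter ι) (fun i => (M i).O)) (f j)) ∧
      ∀ᶠ i in (U : Filter ι), (fun j => f j i) ∈ (M i).I P}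
  A := {a | ∃ s : (i : ι) → V → (M i).O, (∀ i, s i ∈ (M i).A) ∧ a = ultraAssign U M s}

theorem ultraAssign_eq_iff (s t : (i : ι) → V → (M i).O) (x : V) :
    ultraAssign U M s x = ultraAssign U M t x ↔ ∀ᶠ i in (U : Filter ι), s i x = t i x :=
  Quotient.eq (r := productSetoid (U : Filter ι) (fun i => (M i).O))

/-- Finiteness of `X` is essential: only finitely many large index sets are intersected. -/
theorem agree_ultraAssign_iff (X : Finset V) (s t : (i : ι) → V → (M i).O) :
    Agree (X : Set V) (ultraAssign U M s) (ultraAssign U M t) ↔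
      ∀ᶠ i in (U : Filter ι), Agree (X : Set V) (s i) (t i) := by
  simp only [Agree, ultraAssign_eq_iff, Finset.mem_coe]
  exact (Filter.eventually_all_finset X).symm

/-- Łoś's theorem for LFD. -/
theorem sat_ultraproduct (φ : Formula V ar) :
    ∀ s : (i : ι) → V → (M i).O, (∀ i, s i ∈ (M i).A) →
      ((ultraproduct U M).Sat (ultraAssign U M s) φ ↔
        ∀ᶠ i in (U : Filter ι), (M i).Sat (s i) φ) := by
  classical
  induction φ with
  | bot =>
    intro s _
    simp only [DepModel.Sat, Filter.eventually_false_iff_eq_bot, false_iff]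
    exact U.neBot.ne
  | atom P x =>
    intro s _
    constructor
    · rintro ⟨f, hf, hI⟩
      have h : ∀ᶠ i in (U : Filter ι), ∀ j, s i (x j) = f j i := by
        rw [Filter.eventually_all]
        exact fun j => Quotient.exact (hf j)
      filter_upwards [hI, h] with i hi hj
      have e : (fun j => s i (x j)) = fun j => f j i := funext hj
      simpa only [DepModel.Sat, e] using hi
    · intro h
      exact ⟨fun j i => s i (x j), fun _ => rfl, h⟩
  | neg φ ih =>
    intro s hs
    simp only [DepModel.Sat, ih s hs, Ultrafilter.eventually_not]
  | and φ ψ ih₁ ih₂ =>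
    intro s hs
    simp only [DepModel.Sat, ih₁ s hs, ih₂ s hs, Filter.eventually_and]
  | box X φ ih =>
    intro s hs
    constructor
    · intro h
      by_contra hn
      rw [← Ultrafilter.eventually_not] at hn
      -- At indices where the box holds, `s i` itself serves as a harmless default, so that the
      -- chosen family is admissible everywhere.
      have key : ∀ i, ∃ t ∈ (M i).A, ¬ (M i).Sat (s i) (.box X φ) →
          Agree (X : Set V) (s i) t ∧ ¬ (M i).Sat t φ := by
        intro i
        by_cases hi : (M i).Sat (s i) (.box X φ)
        · exact ⟨s i, hs i, fun h => absurd hi h⟩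
        · have hi' := hi
          simp only [DepModel.Sat] at hi'
          push Not at hi'
          obtain ⟨t, ht, ha, hφ⟩ := hi'
          exact ⟨t, ht, fun _ => ⟨ha, hφ⟩⟩
      choose t ht htφ using key
      have h1 := h _ ⟨t, ht, rfl⟩
        ((agree_ultraAssign_iff U M X s t).2 (hn.mono fun i hi => (htφ i hi).1))
      rw [ih t ht] at h1
      obtain ⟨i, hi, hi'⟩ := (h1.and hn).exists
      exact (htφ i hi').2 hi
    · rintro h _ ⟨t, ht, rfl⟩ hst
      replace hst := (agree_ultraAssign_iff U M X s t).1 hst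
      rw [ih t ht]
      filter_upwards [h, hst] with i hi ha using hi _ (ht i) ha
  | dep X y =>
    intro s hs
    constructor
    · intro h
      by_contra hn
      rw [← Ultrafilter.eventually_not] at hn
      have key : ∀ i, ∃ t ∈ (M i).A, ¬ (M i).Sat (s i) (.dep X y) →
          Agree (X : Set V) (s i) t ∧ s i y ≠ t y := by
        intro i
        by_cases hi : (M i).Sat (s i) (.dep X y)
        · exact ⟨s i, hs i, fun h => absurd hi h⟩
        · have hi' := hi
          simp only [DepModel.Sat, DepModel.LocDep] at hi'
          push Not at hi'
          obtain ⟨t, ht, ha, hy⟩ := hi'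
          exact ⟨t, ht, fun _ => ⟨ha, hy⟩⟩
      choose t ht hty using key
      have h1 := h _ ⟨t, ht, rfl⟩
        ((agree_ultraAssign_iff U M X s t).2 (hn.mono fun i hi => (hty i hi).1))
      replace h1 := (ultraAssign_eq_iff U M s t y).1 h1
      obtain ⟨i, hi, hi'⟩ := (h1.and hn).exists
      exact (hty i hi').2 hi
    · rintro h _ ⟨t, ht, rfl⟩ hst
      replace hst := (agree_ultraAssign_iff U M X s t).1 hst
      refine (ultraAssign_eq_iff U M s t y).2 ?_
      filter_upwards [h, hst] with i hi ha using hi _ (ht i) ha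

end Ultraproduct

theorem compactness {T : Set (Formula V ar)}
    (h : ∀ F : Finset (Formula V ar), (F : Set (Formula V ar)) ⊆ T →
      Satisfiable (F : Set (Formula V ar))) : Satisfiable T := by
  classical
  let ι := {F : Finset (Formula V ar) // (F : Set (Formula V ar)) ⊆ T}
  have : Nonempty ι := ⟨⟨∅, by simp⟩⟩
  have : IsDirected ι (· ≤ ·) := ⟨fun F G => ⟨⟨F.1 ∪ G.1, by
    rw [Finset.coe_union]; exact Set.union_subset F.2 G.2⟩,
    Finset.subset_union_left, Finset.subset_union_right⟩⟩
  have h' : ∀ i : ι, Satisfiable (i.1 : Set (Formula V ar)) := fun i => h i.1 i.2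
  choose M s hs hsat using h'
  -- Finite subsets of `T` are directed by inclusion, so each `φ ∈ T` belongs to all sufficiently
  -- late indices, hence to a `U`-large set of them.
  let U : Ultrafilter ι := Ultrafilter.of atTop
  refine ⟨ultraproduct U M, ultraAssign U M s, ⟨s, hs, rfl⟩, fun φ hφ => ?_⟩
  rw [sat_ultraproduct U M φ s hs]
  have hle : (U : Filter ι) ≤ atTop := Ultrafilter.of_le _
  refine hle ?_
  have hφ' : ((({φ} : Finset (Formula V ar))) : Set (Formula V ar)) ⊆ T := by simpa using hφ
  filter_upwards [Filter.eventually_ge_atTop (⟨{φ}, hφ'⟩ : ι)] with i hi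
  exact hsat i φ (hi (Finset.mem_singleton_self φ))

/-! ### Separation and reduction to finite sets -/

/-- The formula `φ` follows from the set `T`. -/
def Entails (T : Set (Formula V ar)) (φ : Formula V ar) : Prop :=
  ∀ M : DepModel.{u, v, max u v} V ar, ∀ s ∈ M.A, (∀ ψ ∈ T, M.Sat s ψ) → M.Sat s φ

/-- A set of formulas that contains `⊤` and is closed under conjunction. -/
structure ConjClosed (S : Set (Formula V ar)) : Prop where
  top_mem : Formula.neg .bot ∈ S
  and_mem : ∀ φ ∈ S, ∀ ψ ∈ S, Formula.and φ ψ ∈ S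

theorem ConjClosed.exists_forall_sat {S : Set (Formula V ar)} (hS : ConjClosed S)
    (F : Finset (Formula V ar)) :
    ∃ φ ∈ S, ∀ M : DepModel.{u, v, max u v} V ar, ∀ s, M.Sat s φ →
      ∀ ψ ∈ F, ψ ∈ S → M.Sat s ψ := by
  classical
  induction F using Finset.induction_on with
  | empty => exact ⟨_, hS.top_mem, by simp⟩
  | insert χ F _ ih =>
    obtain ⟨φ, hφ, h⟩ := ih
    by_cases hχ : χ ∈ S
    · refine ⟨_, hS.and_mem _ hχ _ hφ, fun M s hs ψ hψ hψS => ?_⟩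
      rcases Finset.mem_insert.1 hψ with rfl | hψ
      · exact hs.1
      · exact h M s hs.2 ψ hψ hψS
    · refine ⟨φ, hφ, fun M s hs ψ hψ hψS => ?_⟩
      rcases Finset.mem_insert.1 hψ with rfl | hψ
      · exact absurd hψS hχ
      · exact h M s hs ψ hψ hψS

/-- By compactness an inconsistency uses finitely many formulas, and closure under conjunction packs
those of each side into one. -/
theorem exists_separating {S₁ S₂ : Set (Formula V ar)} (h₁ : ConjClosed S₁) (h₂ : ConjClosed S₂)
    (h : ¬ Satisfiable (S₁ ∪ S₂)) :
    ∃ φ ∈ S₁, ∃ ψ ∈ S₂, ∀ M : DepModel.{u, v, max u v} V ar, ∀ s ∈ M.A,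
      M.Sat s φ → ¬ M.Sat s ψ := by
  by_contra hn
  push Not at hn
  refine h (compactness fun F hF => ?_)
  obtain ⟨φ, hφ, hφF⟩ := h₁.exists_forall_sat F
  obtain ⟨ψ, hψ, hψF⟩ := h₂.exists_forall_sat F
  obtain ⟨M, s, hs, h1, h2⟩ := hn φ hφ ψ hψ
  exact ⟨M, s, hs, fun χ hχ => (hF hχ).elim (hφF M s h1 χ hχ) (hψF M s h2 χ hχ)⟩

theorem conjClosed_entails (T : Set (Formula V ar)) : ConjClosed {φ | Entails T φ} where
  top_mem := fun _ _ _ _ h => h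
  and_mem := fun _ h₁ _ h₂ M s hs h => ⟨h₁ M s hs h, h₂ M s hs h⟩

theorem ConjClosed.inter {S₁ S₂ : Set (Formula V ar)} (h₁ : ConjClosed S₁)
    (h₂ : ConjClosed S₂) : ConjClosed (S₁ ∩ S₂) where
  top_mem := ⟨h₁.top_mem, h₂.top_mem⟩
  and_mem := fun φ hφ ψ hψ => ⟨h₁.and_mem φ hφ.1 ψ hψ.1, h₂.and_mem φ hφ.2 ψ hψ.2⟩

/-- The formulas over the variables in `U` and the predicate symbols in `Q`. -/
def Lang (U : Set V) (Q : Set Pred) : Set (Formula V ar) := {φ | φ.vars ⊆ U ∧ φ.preds ⊆ Q}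

theorem conjClosed_lang (U : Set V) (Q : Set Pred) :
    ConjClosed (Lang U Q : Set (Formula V ar)) where
  top_mem := ⟨Set.empty_subset _, Set.empty_subset _⟩
  and_mem := fun _ h₁ _ h₂ => ⟨Set.union_subset h₁.1 h₂.1, Set.union_subset h₁.2 h₂.2⟩

theorem validSeq_iff_not_satisfiable (Γ Δ : Set (Formula V ar)) :
    ValidSeq Γ Δ ↔ ¬ Satisfiable (Γ ∪ Formula.neg '' Δ) := by
  constructor
  · rintro h ⟨M, s, hs, hsat⟩
    obtain ⟨ψ, hψ, hψs⟩ := h M s hs fun φ hφ => hsat φ (.inl hφ)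
    exact hsat _ (.inr ⟨ψ, hψ, rfl⟩) hψs
  · intro h M s hs hΓ
    by_contra hn
    push Not at hn
    refine h ⟨M, s, hs, ?_⟩
    rintro φ (hφ | ⟨ψ, hψ, rfl⟩)
    · exact hΓ φ hφ
    · exact hn ψ hψ

/-- A valid sequent has a valid subsequent with finite left-hand side. -/
theorem ValidSeq.exists_finite {Γ Δ : Set (Formula V ar)} (h : ValidSeq Γ Δ) :
    ∃ Γ' ⊆ Γ, ∃ Δ' ⊆ Δ, Γ'.Finite ∧ ValidSeq Γ' Δ' := by
  classical
  rw [validSeq_iff_not_satisfiable] at h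
  have : ∃ F : Finset (Formula V ar), (F : Set (Formula V ar)) ⊆ Γ ∪ Formula.neg '' Δ ∧
      ¬ Satisfiable (F : Set (Formula V ar)) := by
    by_contra hn
    push Not at hn
    exact h (compactness hn)
  obtain ⟨F, hF, hFs⟩ := this
  refine ⟨Γ ∩ F, Set.inter_subset_left, Δ ∩ Formula.neg ⁻¹' F, Set.inter_subset_left,
    F.finite_toSet.inter_of_right _, ?_⟩
  rw [validSeq_iff_not_satisfiable]
  rintro ⟨M, s, hs, hsat⟩
  refine hFs ⟨M, s, hs, fun φ hφ => ?_⟩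
  rcases hF hφ with hφΓ | ⟨ψ, hψ, rfl⟩
  · exact hsat _ (.inl ⟨hφΓ, hφ⟩)
  · exact hsat _ (.inr ⟨ψ, ⟨hψ, hφ⟩, rfl⟩)

theorem Formula.finite_vars (φ : Formula V ar) : φ.vars.Finite := by
  induction φ with
  | bot => exact Set.finite_empty
  | atom P x => exact Set.finite_range x
  | neg φ ih => exact ih
  | and φ ψ ih₁ ih₂ => exact ih₁.union ih₂
  | box X φ ih => exact X.finite_toSet.union ih
  | dep X y => exact X.finite_toSet.union (Set.finite_singleton y)

theorem finite_Var {Γ : Set (Formula V ar)} (h : Γ.Finite) : (Var Γ).Finite :=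
  h.biUnion fun φ _ => φ.finite_vars

theorem mem_lang_of_mem {Γ : Set (Formula V ar)} {φ : Formula V ar} (h : φ ∈ Γ) :
    φ ∈ Lang (Var Γ) (PredSym Γ) :=
  ⟨Set.subset_biUnion_of_mem (u := Formula.vars) h,
    Set.subset_biUnion_of_mem (u := Formula.preds) h⟩

/-! ### Complete theories -/

/-- `T` is the set of all formulas true at some admissible assignment. -/
def IsType (T : Set (Formula V ar)) : Prop :=
  ∃ M : DepModel.{u, v, max u v} V ar, ∃ s ∈ M.A, T = {φ | M.Sat s φ}

theorem Satisfiable.exists_isType {S : Set (Formula V ar)} (h : Satisfiable S) :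
    ∃ T, IsType T ∧ S ⊆ T := by
  obtain ⟨M, s, hs, hS⟩ := h
  exact ⟨_, ⟨M, s, hs, rfl⟩, hS⟩

theorem Agree.symm {O : Type w} {X : Set V} {s t : V → O} (h : Agree X s t) : Agree X t s :=
  fun x hx => (h x hx).symm

theorem Agree.trans {O : Type w} {X : Set V} {s t r : V → O} (h : Agree X s t)
    (h' : Agree X t r) : Agree X s r :=
  fun x hx => (h x hx).trans (h' x hx)

namespace IsType

variable {T : Set (Formula V ar)} {X Y : Finset V} {y : V} {φ ψ : Formula V ar}

theorem bot_notMem (hT : IsType T) : Formula.bot ∉ T := by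
  obtain ⟨M, s, hs, rfl⟩ := hT
  exact id

theorem neg_mem_iff (hT : IsType T) : Formula.neg φ ∈ T ↔ φ ∉ T := by
  obtain ⟨M, s, hs, rfl⟩ := hT
  exact Iff.rfl

theorem and_mem_iff (hT : IsType T) : Formula.and φ ψ ∈ T ↔ φ ∈ T ∧ ψ ∈ T := by
  obtain ⟨M, s, hs, rfl⟩ := hT
  exact Iff.rfl

theorem conjClosed (hT : IsType T) : ConjClosed T where
  top_mem := hT.neg_mem_iff.2 hT.bot_notMem
  and_mem := fun _ h₁ _ h₂ => hT.and_mem_iff.2 ⟨h₁, h₂⟩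

theorem conjClosed_box (hT : IsType T) (X : Finset V) : ConjClosed {ψ | Formula.box X ψ ∈ T} := by
  obtain ⟨M, s, hs, rfl⟩ := hT
  exact ⟨fun _ _ _ h => h, fun _ h₁ _ h₂ t ht ha => ⟨h₁ t ht ha, h₂ t ht ha⟩⟩

theorem mem_of_box (hT : IsType T) (h : Formula.box X φ ∈ T) : φ ∈ T := by
  obtain ⟨M, s, hs, rfl⟩ := hT
  exact h s hs fun _ _ => rfl

theorem dep_of_mem (hT : IsType T) (h : y ∈ X) : Formula.dep X y ∈ T := by
  obtain ⟨M, s, hs, rfl⟩ := hT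
  exact fun t _ ha => ha y h

theorem dep_trans (hT : IsType T) (h : ∀ x ∈ X, Formula.dep Y x ∈ T)
    (hy : Formula.dep X y ∈ T) : Formula.dep Y y ∈ T := by
  obtain ⟨M, s, hs, rfl⟩ := hT
  exact fun t ht ha => hy t ht fun x hx => h x hx t ht ha

theorem box_box_of_dep (hT : IsType T) (h : ∀ x ∈ X, Formula.dep Y x ∈ T)
    (hφ : Formula.box X φ ∈ T) : Formula.box Y (.box X φ) ∈ T := by
  obtain ⟨M, s, hs, rfl⟩ := hT
  intro t ht ha r hr har
  exact hφ r hr (Agree.trans (fun x hx => h x hx t ht ha) har)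

theorem box_neg_box_of_dep (hT : IsType T) (h : ∀ x ∈ X, Formula.dep Y x ∈ T)
    (hφ : Formula.box X φ ∉ T) : Formula.box Y (.neg (.box X φ)) ∈ T := by
  obtain ⟨M, s, hs, rfl⟩ := hT
  intro t ht ha hb
  refine hφ fun r hr har => hb r hr ?_
  exact Agree.trans (Agree.symm fun x hx => h x hx t ht ha) har

/-- Like `atom_iff_box_atom`, this lets preservation of boxes in `Step` take care of the atomic
cases as well. -/
theorem dep_iff_box_dep (hT : IsType T) :
    Formula.dep X y ∈ T ↔ Formula.box X (.dep X y) ∈ T := by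
  refine ⟨?_, hT.mem_of_box⟩
  obtain ⟨M, s, hs, rfl⟩ := hT
  intro h t ht ha r hr har
  exact (h t ht ha).symm.trans (h r hr (Agree.trans ha har))

theorem atom_iff_box_atom (hT : IsType T) {P : Pred} {x : Fin (ar P) → V} (hx : ∀ i, x i ∈ X) :
    Formula.atom P x ∈ T ↔ Formula.box X (.atom P x) ∈ T := by
  refine ⟨?_, hT.mem_of_box⟩
  obtain ⟨M, s, hs, rfl⟩ := hT
  intro h t ht ha
  have e : (fun i => s (x i)) = fun i => t (x i) := funext fun i => ha _ (hx i)
  have h' : (fun i => s (x i)) ∈ M.I P := h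
  rw [e] at h'
  exact h'

theorem exists_successor (hT : IsType T) (h : Formula.box X φ ∉ T) :
    ∃ T', IsType T' ∧ φ ∉ T' ∧ ∀ ψ, Formula.box X ψ ∈ T → ψ ∈ T' := by
  obtain ⟨M, s, hs, rfl⟩ := hT
  have h' : ¬ ∀ t ∈ M.A, Agree (X : Set V) s t → M.Sat t φ := h
  push Not at h'
  obtain ⟨t, ht, ha, hφ⟩ := h'
  exact ⟨_, ⟨M, t, ht, rfl⟩, hφ, fun ψ hψ => hψ t ht ha⟩

end IsType

/-! ### Transitions between theories and their matching -/

/-- A transition from `T` to `T'` that keeps the values of the variables in `Y`, as seen by the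
variables in `U`: formulas whose truth depends on variables in `Y ∩ U` are preserved, and `Y` is
closed under the dependences of `T`. -/
structure Step (U : Set V) (T : Set (Formula V ar)) (Y : Set V) (T' : Set (Formula V ar)) :
    Prop where
  box_iff : ∀ X : Finset V, (X : Set V) ⊆ U → (X : Set V) ⊆ Y → ∀ φ,
    (Formula.box X φ ∈ T ↔ Formula.box X φ ∈ T')
  dep_closed : ∀ X : Finset V, (X : Set V) ⊆ U → (X : Set V) ⊆ Y → ∀ y ∈ U,
    Formula.dep X y ∈ T → y ∈ Y

/-- Variables in `Y ∩ U` are determined by `X`, so for `Z ⊆ Y ∩ U` both `𝔻_Z φ` and its negation,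
when true, are true throughout the `X`-agreement class; transitivity of dependence closes `Y`. -/
theorem step_of_closure {U Y : Set V} {T T' : Set (Formula V ar)} {X : Finset V} (hT : IsType T)
    (hT' : IsType T') (hY : ∀ x ∈ U, x ∈ Y ↔ Formula.dep X x ∈ T)
    (h : ∀ ψ, Formula.box X ψ ∈ T → ψ ∈ T') : Step U T Y T' where
  box_iff Z hU hZ φ := by
    have hd : ∀ x ∈ Z, Formula.dep X x ∈ T := fun x hx => (hY x (hU hx)).1 (hZ hx)
    refine ⟨fun hφ => h _ (hT.box_box_of_dep hd hφ), fun hφ => ?_⟩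
    by_contra hn
    exact hT'.neg_mem_iff.1 (h _ (hT.box_neg_box_of_dep hd hn)) hφ
  dep_closed Z hU hZ y hy hdep :=
    (hY y hy).2 (hT.dep_trans (fun x hx => (hY x (hU hx)).1 (hZ hx)) hdep)

/-- Two theories contain the same formulas of the language over `U` and `Q`. -/
def Same (U : Set V) (Q : Set Pred) (T₁ T₂ : Set (Formula V ar)) : Prop :=
  ∀ φ ∈ Lang U Q, (φ ∈ T₁ ↔ φ ∈ T₂)

theorem Same.symm {U : Set V} {Q : Set Pred} {T₁ T₂ : Set (Formula V ar)} (h : Same U Q T₁ T₂) :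
    Same U Q T₂ T₁ := fun φ hφ => (h φ hφ).symm

section Zigzag

variable {U₁ U₂ : Set V} {Q : Set Pred} {T₁ T₂ : Set (Formula V ar)}

/-- `Y` is the closure of `X` in `T₁` together with the closure in `T₂` of its common part `Z`. The
second closure adds nothing new in `U₁`: if `y` is common and `D_Z y` is in `T₂`, then this common
formula is in `T₁`, and transitivity gives `D_X y`. Finiteness of the common variables makes `D_Z y`
a formula. -/
theorem exists_closure (hfin : (U₁ ∩ U₂).Finite) (h₁ : IsType T₁) (h₂ : IsType T₂)
    (hsame : Same (U₁ ∩ U₂) Q T₁ T₂) {X : Finset V} (hX : (X : Set V) ⊆ U₁) :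
    ∃ (Y : Set V) (Z : Finset V), (Z : Set V) ⊆ U₁ ∩ U₂ ∧ (∀ x ∈ Z, Formula.dep X x ∈ T₁) ∧
      (X : Set V) ⊆ Y ∧ (∀ x ∈ U₁, x ∈ Y ↔ Formula.dep X x ∈ T₁) ∧
      (∀ x ∈ U₂, x ∈ Y ↔ Formula.dep Z x ∈ T₂) := by
  have hZfin : {x ∈ U₁ ∩ U₂ | Formula.dep X x ∈ T₁}.Finite := hfin.subset (Set.sep_subset _ _)
  obtain ⟨Z, hZ⟩ := hZfin.exists_finset
  have hZU : (Z : Set V) ⊆ U₁ ∩ U₂ := fun x hx => ((hZ x).1 hx).1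
  have hZX : ∀ x ∈ Z, Formula.dep X x ∈ T₁ := fun x hx => ((hZ x).1 hx).2
  refine ⟨{x | x ∈ U₁ ∧ Formula.dep X x ∈ T₁} ∪ {x | x ∈ U₂ ∧ Formula.dep Z x ∈ T₂}, Z, hZU, hZX,
    fun x hx => .inl ⟨hX hx, h₁.dep_of_mem hx⟩, fun x hx => ⟨?_, fun h => .inl ⟨hx, h⟩⟩,
    fun x hx => ⟨?_, fun h => .inr ⟨hx, h⟩⟩⟩
  · rintro (⟨_, h⟩ | ⟨hx2, h⟩)
    · exact h
    · refine h₁.dep_trans hZX ((hsame _ ⟨?_, Set.empty_subset _⟩).2 h)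
      exact Set.union_subset hZU (Set.singleton_subset_iff.2 ⟨hx, hx2⟩)
  · rintro (⟨hx1, h⟩ | ⟨_, h⟩)
    · exact h₂.dep_of_mem ((hZ x).2 ⟨⟨hx1, hx⟩, h⟩)
    · exact h

/-- Both theories stay in place; the step merely renews every variable outside `Y`, among them `y`.
-/
theorem zig_dep (hfin : (U₁ ∩ U₂).Finite) (h₁ : IsType T₁) (h₂ : IsType T₂)
    (hsame : Same (U₁ ∩ U₂) Q T₁ T₂) {X : Finset V} (hX : (X : Set V) ⊆ U₁) {y : V} (hy : y ∈ U₁)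
    (hdep : Formula.dep X y ∉ T₁) :
    ∃ Y : Set V, (X : Set V) ⊆ Y ∧ y ∉ Y ∧ Step U₁ T₁ Y T₁ ∧ Step U₂ T₂ Y T₂ := by
  obtain ⟨Y, Z, -, -, hXY, hY₁, hY₂⟩ := exists_closure hfin h₁ h₂ hsame hX
  exact ⟨Y, hXY, fun h => hdep ((hY₁ y hy).1 h),
    step_of_closure h₁ h₁ hY₁ fun _ => h₁.mem_of_box,
    step_of_closure h₂ h₂ hY₂ fun _ => h₂.mem_of_box⟩

/-- `T₁'` is a successor refuting `φ`, and `T₂'` must absorb its common part. If that were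
inconsistent with the formulas boxed by `Z` in `T₂`, some common `χ ∈ T₁'` would have `𝔻_Z ¬χ ∈ T₂`;
this formula is common, so it passes to `T₁`, and along the step to `T₁'`, which is absurd. -/
theorem zig_box (hfin : (U₁ ∩ U₂).Finite) (h₁ : IsType T₁) (h₂ : IsType T₂)
    (hsame : Same (U₁ ∩ U₂) Q T₁ T₂) {X : Finset V} (hX : (X : Set V) ⊆ U₁) {φ : Formula V ar}
    (hbox : Formula.box X φ ∉ T₁) :
    ∃ T₁' T₂', IsType T₁' ∧ IsType T₂' ∧ Same (U₁ ∩ U₂) Q T₁' T₂' ∧ φ ∉ T₁' ∧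
      ∃ Y : Set V, (X : Set V) ⊆ Y ∧ Step U₁ T₁ Y T₁' ∧ Step U₂ T₂ Y T₂' := by
  obtain ⟨Y, Z, hZ, hZX, hXY, hY₁, hY₂⟩ := exists_closure hfin h₁ h₂ hsame hX
  obtain ⟨T₁', h₁', hφ, hsucc⟩ := h₁.exists_successor hbox
  have hsat : Satisfiable ({ψ | Formula.box Z ψ ∈ T₂} ∪ (T₁' ∩ Lang (U₁ ∩ U₂) Q)) := by
    by_contra hn
    obtain ⟨ψ, hψ, χ, ⟨hχ, hχL⟩, hψχ⟩ := exists_separating (h₂.conjClosed_box Z)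
      (h₁'.conjClosed.inter (conjClosed_lang _ _)) hn
    have hb : Formula.box Z (.neg χ) ∈ T₂ := by
      obtain ⟨M, s, hs, rfl⟩ := h₂
      exact fun t ht ha => hψχ M t ht (hψ t ht ha)
    have hb' : Formula.box Z (.neg χ) ∈ T₁ :=
      (hsame (.box Z (.neg χ)) ⟨Set.union_subset hZ hχL.1, hχL.2⟩).2 hb
    have hst := step_of_closure h₁ h₁' hY₁ hsucc
    have hb'' := (hst.box_iff Z (fun x hx => (hZ hx).1)
      (fun x hx => (hY₁ x (hZ hx).1).2 (hZX x hx)) _).1 hb'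
    exact h₁'.neg_mem_iff.1 (h₁'.mem_of_box hb'') hχ
  obtain ⟨T₂', h₂', hsub⟩ := hsat.exists_isType
  refine ⟨T₁', T₂', h₁', h₂', fun χ hχ => ⟨fun h => hsub (.inr ⟨h, hχ⟩), fun h => ?_⟩, hφ, Y, hXY,
    step_of_closure h₁ h₁' hY₁ hsucc, step_of_closure h₂ h₂' hY₂ fun ψ hψ => hsub (.inl hψ)⟩
  by_contra hn
  exact h₂'.neg_mem_iff.1 (hsub (.inr ⟨h₁'.neg_mem_iff.2 hn, hχ⟩)) h

end Zigzag

/-! ### The model of histories -/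

section History

variable {W : Type w}

/-- The world reached by a history, whose steps are listed latest first. -/
def current (w₀ : W) : List (W × Set V) → W
  | [] => w₀
  | p :: _ => p.1

/-- Each step of the history is a transition of `E`. -/
def IsHistory (E : W → Set V → W → Prop) (w₀ : W) : List (W × Set V) → Prop
  | [] => True
  | p :: h => IsHistory E w₀ h ∧ E (current w₀ h) p.2 p.1

open Classical in
/-- The point of the history at which the variable `x` got its present value. -/
noncomputable def value : List (W × Set V) → V → List (W × Set V)
  | [], _ => []
  | p :: h, x => if x ∈ p.2 then value h x else p :: h

theorem value_cons_of_mem {p : W × Set V} {x : V} (h : List (W × Set V)) (hx : x ∈ p.2) :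
    value (p :: h) x = value h x := by
  simp [value, hx]

theorem value_cons_of_notMem {p : W × Set V} {x : V} (h : List (W × Set V)) (hx : x ∉ p.2) :
    value (p :: h) x = p :: h := by
  simp [value, hx]

theorem value_suffix (h : List (W × Set V)) (x : V) : value h x <:+ h := by
  induction h with
  | nil => exact List.suffix_rfl
  | cons p h ih =>
    by_cases hx : x ∈ p.2
    · rw [value_cons_of_mem h hx]
      exact ih.trans (List.suffix_cons p h)
    · rw [value_cons_of_notMem h hx]

/-- A function of histories that is invariant under steps that keep `X` takes equal values at
histories that agree on `X`. -/
theorem eq_of_value_eq {E : W → Set V → W → Prop} {w₀ : W} {X : Set V} {α : Sort*}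
    (F : List (W × Set V) → α)
    (hF : ∀ p h, IsHistory E w₀ (p :: h) → X ⊆ p.2 → F (p :: h) = F h) :
    ∀ h h' : List (W × Set V), IsHistory E w₀ h → IsHistory E w₀ h' →
      (∀ x ∈ X, value h x = value h' x) → F h = F h' := by
  -- Strip the latest steps while they keep all of `X`. What remains is empty or equals the value of
  -- some `x ∈ X`; two such remainders that agree on `X` are suffixes of each other.
  have red : ∀ h : List (W × Set V), IsHistory E w₀ h → ∃ g, IsHistory E w₀ g ∧ F h = F g ∧
      (∀ x ∈ X, value h x = value g x) ∧ (g = [] ∨ ∃ x ∈ X, value g x = g) := by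
    intro h
    induction h with
    | nil => exact fun hh => ⟨[], hh, rfl, fun _ _ => rfl, .inl rfl⟩
    | cons p h ih =>
      intro hh
      by_cases hX : X ⊆ p.2
      · obtain ⟨g, hg, hFg, hv, hor⟩ := ih hh.1
        exact ⟨g, hg, (hF p h hh hX).trans hFg,
          fun x hx => (value_cons_of_mem h (hX hx)).trans (hv x hx), hor⟩
      · obtain ⟨x, hx, hxp⟩ := Set.not_subset.1 hX
        exact ⟨p :: h, hh, rfl, fun _ _ => rfl, .inr ⟨x, hx, value_cons_of_notMem h hxp⟩⟩
  intro h h' hh hh' hv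
  obtain ⟨g, -, hFg, hvg, hor⟩ := red h hh
  obtain ⟨g', -, hFg', hvg', hor'⟩ := red h' hh'
  have hgg : ∀ x ∈ X, value g x = value g' x := fun x hx =>
    (hvg x hx).symm.trans ((hv x hx).trans (hvg' x hx))
  have s1 : g <:+ g' := by
    rcases hor with rfl | ⟨x, hx, e⟩
    · exact List.nil_suffix
    · rw [← e, hgg x hx]
      exact value_suffix g' x
  have s2 : g' <:+ g := by
    rcases hor' with rfl | ⟨x, hx, e⟩
    · exact List.nil_suffix
    · rw [← e, ← hgg x hx]
      exact value_suffix g x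
  rw [hFg, hFg', s1.eq_of_length_le s2.length_le]

/-- The assignment at a history; values are tagged by variables. -/
noncomputable def histAssign (h : List (W × Set V)) : V → List (W × Set V) × V :=
  fun x => (value h x, x)

theorem agree_histAssign_iff {X : Set V} {h h' : List (W × Set V)} :
    Agree X (histAssign h) (histAssign h') ↔ ∀ x ∈ X, value h x = value h' x := by
  simp [Agree, histAssign]

end History

/-- The dependence model whose admissible assignments are those of the histories of `E`. -/
noncomputable def historyModel {W : Type (max u v)} (E : W → Set V → W → Prop) (w₀ : W)
    (At : W → (P : Pred) → (Fin (ar P) → V) → Prop) : DepModel.{u, v, max u v} V ar where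
  O := List (W × Set V) × V
  I P := {o | ∃ h, IsHistory E w₀ h ∧ ∃ x : Fin (ar P) → V, At (current w₀ h) P x ∧
    o = fun i => histAssign h (x i)}
  A := {a | ∃ h, IsHistory E w₀ h ∧ a = histAssign h}

/-- The truth lemma for one projection `π` of the worlds, so that the same model serves both
theories. Failing boxes and dependences are refuted by appending one step; true ones persist by
`eq_of_value_eq`. -/
theorem sat_historyModel_iff {W : Type (max u v)} {E : W → Set V → W → Prop} {w₀ : W}
    {At : W → (P : Pred) → (Fin (ar P) → V) → Prop}
    (hAt : ∀ w Y w' P x, E w Y w' → Set.range x ⊆ Y → (At w P x ↔ At w' P x))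
    {U : Set V} {Q : Set Pred} (π : W → Set (Formula V ar)) (htype : ∀ w, IsType (π w))
    (hstep : ∀ w Y w', E w Y w' → Step U (π w) Y (π w'))
    (hbox : ∀ w (X : Finset V) φ, (X : Set V) ⊆ U → Formula.box X φ ∉ π w →
      ∃ Y w', E w Y w' ∧ (X : Set V) ⊆ Y ∧ φ ∉ π w')
    (hdep : ∀ w (X : Finset V) y, (X : Set V) ⊆ U → y ∈ U → Formula.dep X y ∉ π w →
      ∃ Y w', E w Y w' ∧ (X : Set V) ⊆ Y ∧ y ∉ Y)
    (hatom : ∀ w P x, P ∈ Q → Set.range x ⊆ U → (At w P x ↔ Formula.atom P x ∈ π w))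
    (φ : Formula V ar) (hφ : φ ∈ Lang U Q) :
    ∀ h, IsHistory E w₀ h →
      ((historyModel E w₀ At).Sat (histAssign h) φ ↔ φ ∈ π (current w₀ h)) := by
  induction φ with
  | bot => exact fun h _ => ⟨False.elim, fun hb => (htype _).bot_notMem hb⟩
  | atom P x =>
    intro h hh
    rw [← hatom (current w₀ h) P x (hφ.2 rfl) hφ.1]
    constructor
    · rintro ⟨h', hh', x', hx', e⟩
      -- The variable tags recover the argument tuple from the objects.
      have hxx : x = x' := funext fun i => congrArg Prod.snd (congrFun e i)
      subst hxx
      have hv : ∀ y ∈ Set.range x, value h y = value h' y := by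
        rintro _ ⟨i, rfl⟩
        exact congrArg Prod.fst (congrFun e i)
      have := eq_of_value_eq (E := E) (w₀ := w₀) (X := Set.range x)
        (fun h => At (current w₀ h) P x)
        (fun p h hp hX => propext (hAt _ _ _ P x hp.2 hX).symm) h h' hh hh' hv
      exact this.mpr hx'
    · intro hx
      exact ⟨h, hh, x, hx, rfl⟩
  | neg φ ih =>
    intro h hh
    rw [(htype _).neg_mem_iff, ← ih hφ h hh]
    rfl
  | and φ ψ ih₁ ih₂ =>
    intro h hh
    rw [(htype _).and_mem_iff,
      ← ih₁ ⟨fun x hx => hφ.1 (.inl hx), fun x hx => hφ.2 (.inl hx)⟩ h hh,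
      ← ih₂ ⟨fun x hx => hφ.1 (.inr hx), fun x hx => hφ.2 (.inr hx)⟩ h hh]
    rfl
  | box X φ ih =>
    have hXU : (X : Set V) ⊆ U := fun x hx => hφ.1 (.inl hx)
    have ih' := ih ⟨fun x hx => hφ.1 (.inr hx), hφ.2⟩
    intro h hh
    constructor
    · intro hs
      by_contra hn
      obtain ⟨Y, w', hE, hXY, hw'⟩ := hbox _ X φ hXU hn
      have hh' : IsHistory E w₀ ((w', Y) :: h) := ⟨hh, hE⟩
      refine hw' ((ih' _ hh').1 (hs _ ⟨_, hh', rfl⟩ (agree_histAssign_iff.2 fun x hx => ?_)))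
      exact (value_cons_of_mem (p := (w', Y)) h (hXY hx)).symm
    · rintro hb _ ⟨h', hh', rfl⟩ ha
      replace ha := agree_histAssign_iff.1 ha
      have := eq_of_value_eq (E := E) (w₀ := w₀) (X := (X : Set V))
        (fun h => Formula.box X φ ∈ π (current w₀ h))
        (fun p h hp hX => propext ((hstep _ _ _ hp.2).box_iff X hXU hX φ).symm) h h' hh hh' ha
      exact (ih' h' hh').2 ((htype _).mem_of_box (this.mp hb))
  | dep X y =>
    have hXU : (X : Set V) ⊆ U := fun x hx => hφ.1 (.inl hx)
    have hyU : y ∈ U := hφ.1 (.inr rfl)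
    intro h hh
    constructor
    · intro hs
      by_contra hn
      obtain ⟨Y, w', hE, hXY, hyY⟩ := hdep _ X y hXU hyU hn
      have hh' : IsHistory E w₀ ((w', Y) :: h) := ⟨hh, hE⟩
      have e := hs _ ⟨_, hh', rfl⟩ (agree_histAssign_iff.2 fun x hx =>
        (value_cons_of_mem (p := (w', Y)) h (hXY hx)).symm)
      have e' : value h y = (w', Y) :: h :=
        (congrArg Prod.fst e).trans (value_cons_of_notMem (p := (w', Y)) h hyY)
      have := (value_suffix h y).length_le
      rw [e', List.length_cons] at this
      omega
    · rintro hd _ ⟨h', hh', rfl⟩ ha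
      replace ha := agree_histAssign_iff.1 ha
      -- The value of `y` alone is not invariant. This set is `{value h y}` where `D_X y` holds and
      -- empty elsewhere; a step keeping `X` preserves `D_X y` and, when it holds, also keeps `y`.
      have key := eq_of_value_eq (E := E) (w₀ := w₀) (X := (X : Set V))
        (fun h => {g | Formula.dep X y ∈ π (current w₀ h) ∧ g = value h y})
        (fun p h hp hX => by
          have hst := hstep _ _ _ hp.2
          have e : Formula.dep X y ∈ π (current w₀ h) ↔ Formula.dep X y ∈ π p.1 := by
            rw [(htype _).dep_iff_box_dep, (htype p.1).dep_iff_box_dep]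
            exact hst.box_iff X hXU hX _
          ext g
          change (Formula.dep X y ∈ π p.1 ∧ g = value (p :: h) y) ↔
            (Formula.dep X y ∈ π (current w₀ h) ∧ g = value h y)
          rw [← e]
          refine and_congr_right fun hd => ?_
          rw [value_cons_of_mem h (hst.dep_closed X hXU hX y hyU hd)]) h h' hh hh' ha
      have hmem : value h y ∈ {g | Formula.dep X y ∈ π (current w₀ h) ∧ g = value h y} :=
        ⟨hd, rfl⟩
      rw [key] at hmem
      exact Prod.ext hmem.2 rfl

/-! ### Amalgamation and interpolation -/

theorem Step.atom_iff {U Y : Set V} {T T' : Set (Formula V ar)} (hst : Step U T Y T')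
    (hT : IsType T) (hT' : IsType T') {P : Pred} {x : Fin (ar P) → V} (hU : Set.range x ⊆ U)
    (hY : Set.range x ⊆ Y) : Formula.atom P x ∈ T ↔ Formula.atom P x ∈ T' := by
  classical
  have hx : ∀ i, x i ∈ Finset.univ.image x := fun i =>
    Finset.mem_image_of_mem x (Finset.mem_univ i)
  rw [hT.atom_iff_box_atom hx, hT'.atom_iff_box_atom hx]
  exact hst.box_iff _ (by simpa using hU) (by simpa using hY) _

/-- Complete theories that agree on the common language can be realized jointly. -/
theorem amalgamation {U₁ U₂ : Set V} {Q₁ Q₂ : Set Pred} (hfin : (U₁ ∩ U₂).Finite)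
    {T₁ T₂ : Set (Formula V ar)} (h₁ : IsType T₁) (h₂ : IsType T₂)
    (hsame : Same (U₁ ∩ U₂) (Q₁ ∩ Q₂) T₁ T₂) :
    ∃ M : DepModel.{u, v, max u v} V ar, ∃ s ∈ M.A,
      (∀ φ ∈ Lang U₁ Q₁, M.Sat s φ ↔ φ ∈ T₁) ∧ (∀ φ ∈ Lang U₂ Q₂, M.Sat s φ ↔ φ ∈ T₂) := by
  let W := {p : Set (Formula V ar) × Set (Formula V ar) //
    IsType p.1 ∧ IsType p.2 ∧ Same (U₁ ∩ U₂) (Q₁ ∩ Q₂) p.1 p.2}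
  let E : W → Set V → W → Prop := fun p Y q =>
    Step U₁ p.1.1 Y q.1.1 ∧ Step U₂ p.1.2 Y q.1.2
  -- Either theory may make an atom true within its own language; on atoms of both languages they
  -- agree, so neither overrides the other.
  let At : W → (P : Pred) → (Fin (ar P) → V) → Prop := fun p P x =>
    (P ∈ Q₁ ∧ Set.range x ⊆ U₁ ∧ Formula.atom P x ∈ p.1.1) ∨
      (P ∈ Q₂ ∧ Set.range x ⊆ U₂ ∧ Formula.atom P x ∈ p.1.2)
  have hAt : ∀ w Y w' P x, E w Y w' → Set.range x ⊆ Y → (At w P x ↔ At w' P x) := by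
    intro w Y w' P x hE hx
    refine or_congr (and_congr_right fun _ => and_congr_right fun hU => ?_)
      (and_congr_right fun _ => and_congr_right fun hU => ?_)
    · exact hE.1.atom_iff w.2.1 w'.2.1 hU hx
    · exact hE.2.atom_iff w.2.2.1 w'.2.2.1 hU hx
  have hcommon : ∀ (w : W) (P : Pred) (x : Fin (ar P) → V), P ∈ Q₁ → P ∈ Q₂ →
      Set.range x ⊆ U₁ → Set.range x ⊆ U₂ →
      (Formula.atom P x ∈ w.1.1 ↔ Formula.atom P x ∈ w.1.2) := fun w P x hP₁ hP₂ hx₁ hx₂ =>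
    w.2.2.2 _ ⟨Set.subset_inter hx₁ hx₂, Set.singleton_subset_iff.2 ⟨hP₁, hP₂⟩⟩
  have hfin' : (U₂ ∩ U₁).Finite := by rwa [Set.inter_comm]
  have hsymm : ∀ w : W, Same (U₂ ∩ U₁) (Q₂ ∩ Q₁) w.1.2 w.1.1 := by
    intro w
    rw [Set.inter_comm U₂, Set.inter_comm Q₂]
    exact w.2.2.2.symm
  let w₀ : W := ⟨(T₁, T₂), h₁, h₂, hsame⟩
  refine ⟨historyModel E w₀ At, histAssign [], ⟨[], trivial, rfl⟩, fun φ hφ => ?_, fun φ hφ => ?_⟩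
  · refine sat_historyModel_iff hAt (fun w => w.1.1) (fun w => w.2.1) (fun _ _ _ h => h.1)
      ?_ ?_ ?_ φ hφ [] trivial
    · intro w X φ hX hn
      obtain ⟨T₁', T₂', h₁', h₂', hs, hφ, Y, hXY, hst₁, hst₂⟩ :=
        zig_box hfin w.2.1 w.2.2.1 w.2.2.2 hX hn
      exact ⟨Y, ⟨(T₁', T₂'), h₁', h₂', hs⟩, ⟨hst₁, hst₂⟩, hXY, hφ⟩
    · intro w X y hX hy hn
      obtain ⟨Y, hXY, hyY, hst₁, hst₂⟩ := zig_dep hfin w.2.1 w.2.2.1 w.2.2.2 hX hy hn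
      exact ⟨Y, w, ⟨hst₁, hst₂⟩, hXY, hyY⟩
    · intro w P x hP hx
      refine ⟨?_, fun h => .inl ⟨hP, hx, h⟩⟩
      rintro (⟨_, _, h⟩ | ⟨hP₂, hx₂, h⟩)
      · exact h
      · exact (hcommon w P x hP hP₂ hx hx₂).2 h
  · refine sat_historyModel_iff hAt (fun w => w.1.2) (fun w => w.2.2.1) (fun _ _ _ h => h.2)
      ?_ ?_ ?_ φ hφ [] trivial
    · intro w X φ hX hn
      obtain ⟨T₂', T₁', h₂', h₁', hs, hφ, Y, hXY, hst₂, hst₁⟩ :=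
        zig_box hfin' w.2.2.1 w.2.1 (hsymm w) hX hn
      rw [Set.inter_comm U₂, Set.inter_comm Q₂] at hs
      exact ⟨Y, ⟨(T₁', T₂'), h₁', h₂', hs.symm⟩, ⟨hst₁, hst₂⟩, hXY, hφ⟩
    · intro w X y hX hy hn
      obtain ⟨Y, hXY, hyY, hst₂, hst₁⟩ := zig_dep hfin' w.2.2.1 w.2.1 (hsymm w) hX hy hn
      exact ⟨Y, w, ⟨hst₁, hst₂⟩, hXY, hyY⟩
    · intro w P x hP hx
      refine ⟨?_, fun h => .inr ⟨hP, hx, h⟩⟩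
      rintro (⟨hP₁, hx₁, h⟩ | ⟨_, _, h⟩)
      · exact (hcommon w P x hP₁ hP hx₁ hx).1 h
      · exact h

/-! ### From inseparability to the interpolant -/

/-- If no formula of the language over `U` and `Q` separates `Γ` from `Δ`, then `Γ` and the
negations of the formulas in `Δ` have completions that agree on this language. -/
theorem exists_types_of_no_separation {Γ Δ : Set (Formula V ar)} {U : Set V} {Q : Set Pred}
    (h : ∀ θ ∈ Lang U Q, ValidSeq Γ {θ} → ¬ ValidSeq {θ} Δ) :
    ∃ T₁ T₂, IsType T₁ ∧ IsType T₂ ∧ Same U Q T₁ T₂ ∧ Γ ⊆ T₁ ∧ Formula.neg '' Δ ⊆ T₂ := by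
  -- `T₂` must include every common consequence of `Γ`; an inconsistency here would produce an
  -- interpolant.
  have hsat₂ : Satisfiable ((Lang U Q ∩ {θ | Entails Γ θ}) ∪
      {ψ | Entails (Formula.neg '' Δ) ψ}) := by
    by_contra hn
    obtain ⟨θ, ⟨hθ, hΓ⟩, ψ, hψ, hθψ⟩ := exists_separating
      ((conjClosed_lang U Q).inter (conjClosed_entails Γ)) (conjClosed_entails _) hn
    refine h θ hθ (fun M s hs hs' => ⟨θ, rfl, hΓ M s hs hs'⟩) fun M s hs hs' => ?_
    by_contra hΔ
    push Not at hΔ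
    refine hθψ M s hs (hs' θ rfl) (hψ M s hs ?_)
    rintro _ ⟨χ, hχ, rfl⟩
    exact hΔ χ hχ
  obtain ⟨T₂, h₂, hT₂⟩ := hsat₂.exists_isType
  -- Otherwise `Γ` entails `¬θ` for some common `θ ∈ T₂`; but then `¬θ` is a common consequence of
  -- `Γ`, already placed in `T₂`.
  have hsat₁ : Satisfiable ({ψ | Entails Γ ψ} ∪ (T₂ ∩ Lang U Q)) := by
    by_contra hn
    obtain ⟨ψ, hψ, θ, ⟨hθ, hθL⟩, hψθ⟩ := exists_separating (conjClosed_entails Γ)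
      (h₂.conjClosed.inter (conjClosed_lang U Q)) hn
    refine h₂.neg_mem_iff.1 (hT₂ (.inl ⟨(?_ : Formula.neg θ ∈ Lang U Q), ?_⟩)) hθ
    · exact hθL
    · exact fun M s hs hs' => hψθ M s hs (hψ M s hs hs')
  obtain ⟨T₁, h₁, hT₁⟩ := hsat₁.exists_isType
  refine ⟨T₁, T₂, h₁, h₂, fun θ hθ => ⟨fun h => ?_, fun h => hT₁ (.inr ⟨h, hθ⟩)⟩,
    fun φ hφ => hT₁ (.inl fun M s _ hs => hs φ hφ),
    fun φ hφ => hT₂ (.inr fun M s _ hs => hs φ hφ)⟩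
  by_contra hn
  exact h₁.neg_mem_iff.1 (hT₁ (.inr ⟨h₂.neg_mem_iff.2 hn, hθ⟩)) h

theorem exists_strongInterpolant_of_finite {Γ Δ : Set (Formula V ar)} (hΓ : Γ.Finite)
    (h : ValidSeq Γ Δ) : ∃ θ, StrongInterpolant Γ Δ θ := by
  by_contra hn
  obtain ⟨T₁, T₂, h₁, h₂, hsame, hΓT, hΔT⟩ := exists_types_of_no_separation
    (Γ := Γ) (Δ := Δ) (U := Var Γ ∩ Var Δ) (Q := PredSym Γ ∩ PredSym Δ)
    fun θ hθ hl hr => hn ⟨θ, hl, hr, hθ.2, hθ.1⟩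
  obtain ⟨M, s, hs, hs₁, hs₂⟩ := amalgamation ((finite_Var hΓ).inter_of_left _) h₁ h₂ hsame
  obtain ⟨ψ, hψ, hψs⟩ := h M s hs fun φ hφ => (hs₁ φ (mem_lang_of_mem hφ)).2 (hΓT hφ)
  exact h₂.neg_mem_iff.1 (hΔT ⟨ψ, hψ, rfl⟩) ((hs₂ ψ (mem_lang_of_mem hψ)).1 hψs)

theorem StrongInterpolant.mono {Γ Γ' Δ Δ' : Set (Formula V ar)} {θ : Formula V ar}
    (h : StrongInterpolant Γ' Δ' θ) (hΓ : Γ' ⊆ Γ) (hΔ : Δ' ⊆ Δ) : StrongInterpolant Γ Δ θ where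
  valid_left M s hs hs' := h.valid_left M s hs fun φ hφ => hs' φ (hΓ hφ)
  valid_right M s hs hs' := by
    obtain ⟨ψ, hψ, hψs⟩ := h.valid_right M s hs hs'
    exact ⟨ψ, hΔ hψ, hψs⟩
  preds_subset := h.preds_subset.trans
    (Set.inter_subset_inter (Set.biUnion_subset_biUnion_left hΓ)
      (Set.biUnion_subset_biUnion_left hΔ))
  vars_subset := h.vars_subset.trans
    (Set.inter_subset_inter (Set.biUnion_subset_biUnion_left hΓ)
      (Set.biUnion_subset_biUnion_left hΔ))

end LFD

theorem theorem5p7 {V : Type u} {Pred : Type v} {ar : Pred → ℕ}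
    (Γ Δ : Set (LFD.Formula V ar)) (h : LFD.ValidSeq Γ Δ) :
    ∃ θ : LFD.Formula V ar, LFD.StrongInterpolant Γ Δ θ := by
  obtain ⟨Γ', hΓ, Δ', hΔ, hfin, hv⟩ := h.exists_finite
  obtain ⟨θ, hθ⟩ := LFD.exists_strongInterpolant_of_finite hfin hv
  exact ⟨θ, hθ.mono hΓ hΔ⟩
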